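/- An mm-space is a complete separable metric space $X$ with metric $d_X$ and a Borel probability measure $\mu_X$ such that $X=\operatorname{supp}\mu_X$. Two mm-spaces $X,Y$ are mm-isomorphic if there is an isometry $f:X\to Y$ with $f_*\mu_X=\mu_Y$; let $\mathcal X$ be the set of mm-isomorphism classes. Write $Y\prec X$ if there is a $1$-Lipschitz map $f:X\to Y$ with $f_*\mu_X=\mu_Y$. The box distance $\square(X,Y)$ is the infimum of those $\varepsilon\ge 0$ for which there are Borel maps $\varphi:[0,1)\to X$ and $\psi:[0,1)\to Y$ pushing the Lebesgue measure $\mathcal L^1$ forward to $\mu_X$ and $\mu_Y$ respectively, and a Borel set $I_0\subset[0,1)$ with $\mathcal L^1(I_0)\ge 1-\varepsilon$ and $|d_X(\varphi(s),\varphi(t))-d_Y(\psi(s),\psi(t))|\le\varepsilon$ for all $s,t\in I_0$. A pyramid is a nonempty, $\square$-closed subset $\mathcal P\subset\mathcal X$ such that (i) if $X\in\mathcal P$ and $Y\prec X$, then $Y\in\mathcal P$; (ii) for any $X,X'\in\mathcal P$ there is $Y\in\mathcal P$ with $X\prec Y$ and $X'\prec Y$. For a Borel measure $\nu$ on $\mathbb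 R$ and $\alpha\in\mathbb R$, let $\operatorname{diam}(\nu;\alpha)$ be the infimum of $\operatorname{diam}(A)$ over all Borel sets $A\subset\mathbb R$ with $\nu(A)\ge\alpha$. For an mm-space $X$ and real $\kappa,\kappa_0,\kappa_1>0$ let $$\operatorname{ObsDiam}(X;-\kappa)=\sup\{\operatorname{diam}(f_*\mu_X;1-\kappa)\mid f:X\to\mathbb R\ \text{is $1$-Lipschitz}\},$$ and let $\operatorname{Sep}(X;\kappa_0,\kappa_1)$ be the supremum of $d_X(A_0,A_1)=\inf_{x\in A_0,\,y\in A_1}d_X(x,y)$ over all Borel sets $A_0,A_1\subset X$ with $\mu_X(A_i)\ge\kappa_i$ for $i=0,1$ (and $0$ if there are no such sets). For a pyramid $\mathcal P$ define, with values in $[0,+\infty]$, $$\operatorname{ObsDiam}(\mathcal P;-\kappa)=\lim_{\delta\to0+}\sup_{X\in\mathcal P}\operatorname{ObsDiam}(X;-(\kappa+\delta)),\qquad \operatorname{Sep}(\mathcal P;\kappa_0,\kappa_1)=\lim_{\delta\to0+}\sup_{X\in\mathcal P}\operatorname{Sep}(X;\kappa_0-\delta,\kappa_1-\delta).$$ Proposition.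 Let $\mathcal P$ be a pyramid. Then for all real numbers $\kappa,\kappa'$ with $0<\kappa'<\kappa$ we have $$\text{(1)}\quad\operatorname{ObsDiam}(\mathcal P;-2\kappa)\le\operatorname{Sep}(\mathcal P;\kappa,\kappa),\qquad\text{(2)}\quad\operatorname{Sep}(\mathcal P;\kappa,\kappa)\le\operatorname{ObsDiam}(\mathcal P;-\kappa').$$ -/

import Mathlib

open MeasureTheory Set Filter Topology
open scoped NNReal ENNReal

universe u

/-- An mm-space: a complete separable metric space with a Borel probability measure
whose support is the whole space. -/
structure MMSpace : Type (u + 1) where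
  /-- The underlying set. -/
  carrier : Type u
  [metric : MetricSpace carrier]
  [complete : CompleteSpace carrier]
  [separable : TopologicalSpace.SeparableSpace carrier]
  [measurableSpace : MeasurableSpace carrier]
  [borel : BorelSpace carrier]
  /-- The measure. -/
  μ : Measure carrier
  [prob : IsProbabilityMeasure μ]
  support_eq : μ.support = Set.univ

namespace MMSpace

instance : CoeSort MMSpace.{u} (Type u) := ⟨MMSpace.carrier⟩

attribute [instance] metric complete separable measurableSpace borel prob

/-- Two mm-spaces (of full support) are mm-isomorphic if there is an isometry between them
that pushes the first measure forward to the second. -/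
def Isomorphic (X Y : MMSpace.{u}) : Prop :=
  ∃ f : X → Y, Isometry f ∧ X.μ.map f = Y.μ

/-- The Lipschitz order: `Y.DominatedBy X` means `Y ≺ X`, that is, there is a `1`-Lipschitz map
`X → Y` pushing the measure of `X` forward to that of `Y`. -/
def DominatedBy (Y X : MMSpace.{u}) : Prop :=
  ∃ f : X → Y, LipschitzWith 1 f ∧ X.μ.map f = Y.μ

/-- An mm-isomorphism is automatically surjective. -/
theorem surjective_of_isometry {X Y : MMSpace.{u}} {f : X → Y} (hf : Isometry f)
    (h : X.μ.map f = Y.μ) : Function.Surjective f := by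
  have hc : IsClosed (Set.range f) := hf.isClosedEmbedding.isClosed_range
  have h0 : Y.μ (Set.range f)ᶜ = 0 := by
    rw [← h, Measure.map_apply hf.continuous.measurable hc.measurableSet.compl]
    have : f ⁻¹' (Set.range f)ᶜ = ∅ := by
      ext x
      simp
    rw [this, measure_empty]
  intro y
  by_contra hy
  have hmem : y ∈ Y.μ.support := by
    rw [Y.support_eq]
    trivial
  have hpos := (Measure.mem_support_iff_forall y).1 hmem (Set.range f)ᶜ
    (hc.isOpen_compl.mem_nhds hy)
  exact hpos.ne' h0

theorem Isomorphic.refl (X : MMSpace.{u}) : X.Isomorphic X :=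
  ⟨id, isometry_id, Measure.map_id⟩

theorem Isomorphic.symm {X Y : MMSpace.{u}} (h : X.Isomorphic Y) : Y.Isomorphic X := by
  obtain ⟨f, hf, hm⟩ := h
  let e : X ≃ᵢ Y := IsometryEquiv.mk
    (Equiv.ofBijective f ⟨hf.injective, surjective_of_isometry hf hm⟩) hf
  refine ⟨e.symm, e.symm.isometry, ?_⟩
  rw [← hm, Measure.map_map e.symm.continuous.measurable hf.continuous.measurable]
  have : e.symm ∘ f = id := by
    funext x
    exact e.symm_apply_apply x
  rw [this, Measure.map_id]

theorem Isomorphic.trans {X Y Z : MMSpace.{u}} (h : X.Isomorphic Y) (h' : Y.Isomorphic Z) :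
    X.Isomorphic Z := by
  obtain ⟨f, hf, hm⟩ := h
  obtain ⟨g, hg, hm'⟩ := h'
  refine ⟨g ∘ f, hg.comp hf, ?_⟩
  rw [← hm', ← hm, Measure.map_map hg.continuous.measurable hf.continuous.measurable]

instance setoid : Setoid MMSpace.{u} where
  r := Isomorphic
  iseqv := ⟨Isomorphic.refl, Isomorphic.symm, Isomorphic.trans⟩

end MMSpace

/-- The set `𝒳` of mm-isomorphism classes of mm-spaces. -/
def MMClass : Type (u + 1) := Quotient MMSpace.setoid.{u}

/-- The mm-isomorphism class of an mm-space. -/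
def MMSpace.cls (X : MMSpace.{u}) : MMClass.{u} := Quotient.mk MMSpace.setoid X

/-- The partial diameter `diam(μ; α)`: the infimum of the diameters of the Borel sets of measure
at least `α`. -/
noncomputable def partialDiam {Z : Type*} [MetricSpace Z] [MeasurableSpace Z]
    (μ : Measure Z) (α : ℝ) : ℝ≥0∞ :=
  ⨅ (A : Set Z) (_ : MeasurableSet A) (_ : ENNReal.ofReal α ≤ μ A), Metric.ediam A

/-- The distance `inf_{x ∈ A, y ∈ B} d(x, y)` between two subsets of a metric space. -/
noncomputable def setDist {Z : Type*} [MetricSpace Z] (A B : Set Z) : ℝ≥0∞ :=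
  ⨅ (x ∈ A) (y ∈ B), edist x y

/-- The one-dimensional Lebesgue measure on `[0,1)`. -/
noncomputable def lebesgueI : Measure (Set.Ico (0 : ℝ) 1) :=
  (volume : Measure ℝ).comap Subtype.val

namespace MMSpace

/-- `X.obsDiam κ` is the observable diameter `ObsDiam(X; -κ)`. -/
noncomputable def obsDiam (X : MMSpace.{u}) (κ : ℝ) : ℝ≥0∞ :=
  ⨆ (f : X → ℝ) (_ : LipschitzWith 1 f), partialDiam (X.μ.map f) (1 - κ)

/-- `X.sep κ` is the separation distance `Sep(X; κ₀, …, κ_N)` (used for `N ≥ 1`). The supremum over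
the empty family is `0`. -/
noncomputable def sep (X : MMSpace.{u}) {N : ℕ} (κ : Fin (N + 1) → ℝ) : ℝ≥0∞ :=
  ⨆ (A : Fin (N + 1) → Set X) (_ : ∀ i, MeasurableSet (A i))
    (_ : ∀ i, ENNReal.ofReal (κ i) ≤ X.μ (A i)),
    ⨅ (i : Fin (N + 1)) (j : Fin (N + 1)) (_ : i ≠ j), setDist (A i) (A j)

/-- A parameter of `X`: a Borel map from `[0,1)` to `X` that pushes Lebesgue measure forward to the
measure of `X`. -/
def IsParameter (X : MMSpace.{u}) (φ : Set.Ico (0 : ℝ) 1 → X) : Prop :=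
  Measurable φ ∧ lebesgueI.map φ = X.μ

/-- The box distance between two mm-spaces. -/
noncomputable def boxDist (X Y : MMSpace.{u}) : ℝ≥0∞ :=
  ⨅ (ε : ℝ≥0) (_ : ∃ (φ : Set.Ico (0 : ℝ) 1 → X) (ψ : Set.Ico (0 : ℝ) 1 → Y)
      (I₀ : Set (Set.Ico (0 : ℝ) 1)),
      X.IsParameter φ ∧ Y.IsParameter ψ ∧ MeasurableSet I₀ ∧
      (∀ s ∈ I₀, ∀ t ∈ I₀, |dist (φ s) (φ t) - dist (ψ s) (ψ t)| ≤ (ε : ℝ)) ∧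
      ENNReal.ofReal (1 - (ε : ℝ)) ≤ lebesgueI I₀), (ε : ℝ≥0∞)

theorem obsDiam_antitone (X : MMSpace.{u}) : Antitone X.obsDiam := by
  intro a b hab
  refine iSup₂_mono fun f _ => ?_
  refine le_iInf₂ fun A hA => le_iInf fun h => ?_
  exact iInf₂_le_of_le A hA
    (iInf_le _ ((ENNReal.ofReal_le_ofReal (by linarith)).trans h))

theorem sep_antitone (X : MMSpace.{u}) {N : ℕ} :
    Antitone (fun κ : Fin (N + 1) → ℝ => X.sep κ) := by
  intro a b hab
  refine iSup₂_mono fun A hA => ?_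
  exact iSup_le fun h => le_iSup_of_le
    (fun i => (ENNReal.ofReal_le_ofReal (hab i)).trans (h i)) le_rfl

end MMSpace

/-- A pyramid: a nonempty set of mm-isomorphism classes of mm-spaces that is downward closed and
directed for the Lipschitz order and closed for the box distance. -/
structure Pyramid : Type (u + 1) where
  /-- The underlying set of isomorphism classes. -/
  carrier : Set MMClass.{u}
  down_closed : ∀ X Y : MMSpace.{u}, X.cls ∈ carrier → Y.DominatedBy X → Y.cls ∈ carrier
  directed : ∀ X X' : MMSpace.{u}, X.cls ∈ carrier → X'.cls ∈ carrier →
    ∃ Y : MMSpace.{u}, Y.cls ∈ carrier ∧ X.DominatedBy Y ∧ X'.DominatedBy Y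
  nonempty : carrier.Nonempty
  box_closed : ∀ X : MMSpace.{u},
    (∀ ε : ℝ≥0∞, 0 < ε → ∃ Y : MMSpace.{u}, Y.cls ∈ carrier ∧ X.boxDist Y < ε) → X.cls ∈ carrier

namespace Pyramid

/-- `P.obsDiam κ` is the observable diameter
`ObsDiam(P; -κ) = lim_{δ → 0+} sup_{X ∈ P} ObsDiam(X; -(κ + δ))` of the pyramid `P`. -/
noncomputable def obsDiam (P : Pyramid.{u}) (κ : ℝ) : ℝ≥0∞ :=
  limUnder (𝓝[>] (0 : ℝ)) fun δ =>
    ⨆ (X : MMSpace.{u}) (_ : X.cls ∈ P.carrier), X.obsDiam (κ + δ)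

/-- `P.sep κ` is the separation distance
`Sep(P; κ₀, …, κ_N) = lim_{δ → 0+} sup_{X ∈ P} Sep(X; κ₀ - δ, …, κ_N - δ)` of the pyramid `P`. -/
noncomputable def sep (P : Pyramid.{u}) {N : ℕ} (κ : Fin (N + 1) → ℝ) : ℝ≥0∞ :=
  limUnder (𝓝[>] (0 : ℝ)) fun δ =>
    ⨆ (X : MMSpace.{u}) (_ : X.cls ∈ P.carrier), X.sep (fun i => κ i - δ)

/-- The limit that defines the observable diameter of a pyramid exists. -/
theorem tendsto_obsDiam (P : Pyramid.{u}) (κ : ℝ) :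
    Tendsto (fun δ : ℝ => ⨆ (X : MMSpace.{u}) (_ : X.cls ∈ P.carrier), X.obsDiam (κ + δ))
      (𝓝[>] (0 : ℝ)) (𝓝 (P.obsDiam κ)) := by
  have h : Antitone
      (fun δ : ℝ => ⨆ (X : MMSpace.{u}) (_ : X.cls ∈ P.carrier), X.obsDiam (κ + δ)) :=
    fun a b hab => iSup₂_mono fun X _ => X.obsDiam_antitone (by linarith)
  exact tendsto_nhds_limUnder ⟨_, h.tendsto_nhdsGT 0⟩

/-- The limit that defines the separation distance of a pyramid exists. -/
theorem tendsto_sep (P : Pyramid.{u}) {N : ℕ} (κ : Fin (N + 1) → ℝ) :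
    Tendsto (fun δ : ℝ => ⨆ (X : MMSpace.{u}) (_ : X.cls ∈ P.carrier), X.sep (fun i => κ i - δ))
      (𝓝[>] (0 : ℝ)) (𝓝 (P.sep κ)) := by
  have h : Monotone
      (fun δ : ℝ => ⨆ (X : MMSpace.{u}) (_ : X.cls ∈ P.carrier), X.sep (fun i => κ i - δ)) :=
    fun a b hab => iSup₂_mono fun X _ => X.sep_antitone fun i => by
      show κ i - b ≤ κ i - a
      linarith
  exact tendsto_nhds_limUnder ⟨_, h.tendsto_nhdsGT 0⟩

end Pyramid

/-!
Both inequalities hold already for every single mm-space `X`, and the pyramid versions follow by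
taking suprema and letting `δ → 0+`.

For (1), let `ν` be the push-forward of the measure of `X` under a `1`-Lipschitz function `f`. If
`a` is a lower and `b` an upper `κ`-quantile of `ν`, then `[a, b]` has measure at least `1 - 2κ`,
while the preimages of `(-∞, a]` and `[b, ∞)` have measure at least `κ` and lie at distance at
least `b - a` (`MMSpace.obsDiam_two_mul_le_sep`).

For (2), let `A₀, A₁` have measure at least `κ > κ'` and let `f` be the distance to `A₀`. A Borel
set of measure at least `1 - κ'` for the push-forward under `f` meets both `f(A₀) = {0}` and
`f(A₁)`, which lies above `d(A₀, A₁)` (`MMSpace.sep_le_obsDiam`).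
-/

open ProbabilityTheory in
/-- Existence of `κ`-quantiles of a probability measure on the line. -/
theorem exists_quantile (ν : Measure ℝ) [IsProbabilityMeasure ν] {κ : ℝ} (h0 : 0 < κ)
    (h1 : κ < 1) :
    ∃ a : ℝ, ENNReal.ofReal κ ≤ ν (Iic a) ∧ ν (Iio a) ≤ ENNReal.ofReal κ := by
  set S : Set ℝ := {t | κ ≤ cdf ν t} with hS
  have hne : S.Nonempty :=
    (((tendsto_cdf_atTop ν).eventually (eventually_gt_nhds h1)).exists).imp fun _ h => le_of_lt h
  obtain ⟨c, hc⟩ := ((tendsto_cdf_atBot ν).eventually (eventually_lt_nhds h0)).exists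
  have hbdd : BddBelow S := ⟨c, fun t ht => by
    by_contra hlt
    exact absurd ((cdf ν).mono (not_le.1 hlt).le) (not_le.2 (hc.trans_le ht))⟩
  have hlow : ∀ t < sInf S, cdf ν t ≤ κ := fun t ht => (not_le.1 fun h => notMem_of_lt_csInf (s := S) ht hbdd h).le
  have hhigh : ∀ t > sInf S, κ ≤ cdf ν t := fun t ht => by
    obtain ⟨s, hs, hst⟩ := exists_lt_of_csInf_lt hne ht
    exact le_trans hs ((cdf ν).mono hst.le)
  refine ⟨sInf S, ?_, ?_⟩
  · rw [← ofReal_cdf]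
    refine ENNReal.ofReal_le_ofReal ?_
    have hr : Tendsto (cdf ν) (𝓝[>] (sInf S)) (𝓝 (cdf ν (sInf S))) :=
      ((cdf ν).right_continuous _).mono_left (nhdsWithin_mono _ Ioi_subset_Ici_self)
    exact ge_of_tendsto hr (eventually_nhdsWithin_of_forall hhigh)
  · rw [← measure_cdf ν, StieltjesFunction.measure_Iio _ (tendsto_cdf_atBot ν), sub_zero]
    exact ENNReal.ofReal_le_ofReal (le_of_tendsto ((cdf ν).mono.tendsto_leftLim _)
      (eventually_nhdsWithin_of_forall hlow))

namespace MMSpace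

theorem le_sep_pair (X : MMSpace.{u}) {κ : ℝ} {A B : Set X} (hA : MeasurableSet A)
    (hB : MeasurableSet B) (hμA : ENNReal.ofReal κ ≤ X.μ A) (hμB : ENNReal.ofReal κ ≤ X.μ B)
    {D : ℝ≥0∞} (hD : ∀ x ∈ A, ∀ y ∈ B, D ≤ edist x y) : D ≤ X.sep ![κ, κ] := by
  refine le_iSup_of_le ![A, B] (le_iSup_of_le (Fin.forall_fin_two.2 ⟨hA, hB⟩)
    (le_iSup_of_le (Fin.forall_fin_two.2 ⟨hμA, hμB⟩) ?_))
  refine le_iInf fun i => le_iInf fun j => le_iInf fun hij => le_iInf₂ fun x hx =>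
    le_iInf₂ fun y hy => ?_
  fin_cases i <;> fin_cases j
  · exact absurd rfl hij
  · exact hD x hx y hy
  · rw [edist_comm]
    exact hD y hy x hx
  · exact absurd rfl hij

theorem obsDiam_two_mul_le_sep (X : MMSpace.{u}) {κ : ℝ} (hκ : 0 < κ) :
    X.obsDiam (2 * κ) ≤ X.sep ![κ, κ] := by
  refine iSup₂_le fun f hf => ?_
  have hfm : Measurable f := hf.continuous.measurable
  rcases le_or_gt (1 / 2) κ with h | h
  · -- the mass requirement `1 - 2 * κ` is nonpositive, so the empty set is admissible
    refine (iInf₂_le_of_le ∅ MeasurableSet.empty (iInf_le _ ?_)).trans ?_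
    · rw [ENNReal.ofReal_of_nonpos (by linarith)]
      exact zero_le
    · simp
  have : IsProbabilityMeasure (X.μ.map f) := Measure.isProbabilityMeasure_map hfm.aemeasurable
  have hgm : Measurable fun x => -f x := hfm.neg
  have : IsProbabilityMeasure (X.μ.map fun x => -f x) :=
    Measure.isProbabilityMeasure_map hgm.aemeasurable
  obtain ⟨a, ha, ha'⟩ := exists_quantile (X.μ.map f) hκ (by linarith)
  -- the upper quantile of `f` is minus the lower quantile of `-f`
  obtain ⟨b, hb, hb'⟩ := exists_quantile (X.μ.map fun x => -f x) hκ (by linarith)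
  rw [Measure.map_apply hfm measurableSet_Iic] at ha
  rw [Measure.map_apply hfm measurableSet_Iio] at ha'
  rw [Measure.map_apply hgm measurableSet_Iic] at hb
  rw [Measure.map_apply hgm measurableSet_Iio] at hb'
  have hmass : ENNReal.ofReal (1 - 2 * κ) ≤ X.μ.map f (Icc a (-b)) := by
    rw [Measure.map_apply hfm measurableSet_Icc]
    have hcover : (univ : Set X) ⊆
        f ⁻¹' Icc a (-b) ∪ (f ⁻¹' Iio a ∪ (fun x => -f x) ⁻¹' Iio b) := by
      intro x _
      rcases lt_or_ge (f x) a with h₁ | h₁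
      · exact Or.inr (Or.inl h₁)
      rcases lt_or_ge (-f x) b with h₂ | h₂
      · exact Or.inr (Or.inr h₂)
      · exact Or.inl ⟨h₁, by linarith⟩
    have hsum : 1 ≤ X.μ (f ⁻¹' Icc a (-b)) + ENNReal.ofReal (2 * κ) := by
      rw [two_mul, ENNReal.ofReal_add hκ.le hκ.le, ← measure_univ (μ := X.μ)]
      exact (measure_mono hcover).trans ((measure_union_le _ _).trans
        (add_le_add le_rfl ((measure_union_le _ _).trans (add_le_add ha' hb'))))
    rw [ENNReal.ofReal_sub _ (by linarith), ENNReal.ofReal_one]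
    exact tsub_le_iff_right.2 hsum
  refine (iInf₂_le_of_le _ measurableSet_Icc (iInf_le _ hmass)).trans ?_
  rw [Real.ediam_Icc]
  refine X.le_sep_pair (hfm measurableSet_Iic) (hgm measurableSet_Iic) ha hb fun x hx y hy => ?_
  simp only [mem_preimage, mem_Iic] at hx hy
  refine le_trans ?_ (by simpa using hf x y)
  rw [edist_dist, dist_comm, Real.dist_eq]
  exact ENNReal.ofReal_le_ofReal (le_trans (by linarith) (le_abs_self _))

theorem nonempty_inter_of_mass {X : MMSpace.{u}} {κ κ' : ℝ} (hκ : κ' < κ)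
    {A B : Set X} (hB : MeasurableSet B) (hμA : ENNReal.ofReal κ ≤ X.μ A)
    (hμB : ENNReal.ofReal (1 - κ') ≤ X.μ B) : (A ∩ B).Nonempty := by
  refine nonempty_inter_of_measure_lt_add X.μ hB (subset_univ A) (subset_univ B) ?_
  refine lt_of_lt_of_le ?_ (add_le_add hμA hμB)
  rw [measure_univ, ← ENNReal.ofReal_one]
  -- `1 - κ'` may be negative, hence the truncated sum is bounded below instead of evaluated
  refine lt_of_lt_of_le ?_ (ENNReal.ofReal_add_le (p := κ) (q := 1 - κ'))
  exact (ENNReal.ofReal_lt_ofReal_iff (by linarith)).2 (by linarith)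

theorem sep_le_obsDiam (X : MMSpace.{u}) {κ κ' : ℝ} (hκ' : 0 < κ') (hκ : κ' < κ) :
    X.sep ![κ, κ] ≤ X.obsDiam κ' := by
  refine iSup₂_le fun A _ => iSup_le fun hμ => ?_
  have hμ₀ : ENNReal.ofReal κ ≤ X.μ (A 0) := hμ 0
  have hμ₁ : ENNReal.ofReal κ ≤ X.μ (A 1) := hμ 1
  have hne : (A 0).Nonempty := nonempty_of_measure_ne_zero (μ := X.μ)
    ((ENNReal.ofReal_pos.2 (hκ'.trans hκ)).trans_le hμ₀).ne'
  have hf : LipschitzWith 1 fun x => Metric.infDist x (A 0) := Metric.lipschitz_infDist_pt (A 0)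
  have hfm := hf.continuous.measurable
  refine (iInf₂_le_of_le 0 1 (iInf_le _ (by decide))).trans ?_
  refine le_iSup₂_of_le _ hf (le_iInf₂ fun B hB => le_iInf fun hνB => ?_)
  rw [Measure.map_apply hfm hB] at hνB
  obtain ⟨x, hx, hxB⟩ := nonempty_inter_of_mass hκ (hfm hB) hμ₀ hνB
  obtain ⟨y, hy, hyB⟩ := nonempty_inter_of_mass hκ (hfm hB) hμ₁ hνB
  refine le_trans ?_ (Metric.edist_le_ediam_of_mem hyB hxB)
  beta_reduce
  rw [Metric.infDist_zero_of_mem hx, edist_dist, Real.dist_eq, sub_zero,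
    abs_of_nonneg Metric.infDist_nonneg, Metric.infDist,
    ENNReal.ofReal_toReal (Metric.infEDist_ne_top hne), Metric.le_infEDist]
  intro z hz
  rw [edist_comm]
  exact (iInf₂_le z hz).trans (iInf₂_le y hy)

end MMSpace

theorem proposition4 (P : Pyramid.{u}) (κ κ' : ℝ) (hκ' : 0 < κ') (hκ : κ' < κ) :
    P.obsDiam (2 * κ) ≤ P.sep ![κ, κ] ∧ P.sep ![κ, κ] ≤ P.obsDiam κ' := by
  have hshift : ∀ δ : ℝ, (fun i => ![κ, κ] i - δ) = ![κ - δ, κ - δ] := fun δ => by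
    ext i
    fin_cases i <;> rfl
  constructor
  · refine le_of_tendsto_of_tendsto (P.tendsto_obsDiam (2 * κ)) (P.tendsto_sep ![κ, κ]) ?_
    filter_upwards [Ioo_mem_nhdsGT (hκ'.trans hκ)] with δ hδ
    refine iSup₂_mono fun X _ => ?_
    rw [hshift]
    exact (X.obsDiam_antitone (by linarith [hδ.1])).trans
      (X.obsDiam_two_mul_le_sep (sub_pos.2 hδ.2))
  · refine le_of_tendsto_of_tendsto (P.tendsto_sep ![κ, κ]) (P.tendsto_obsDiam κ') ?_
    -- for `δ < (κ - κ') / 2` the two shifted levels still satisfy `κ' + δ < κ - δ`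
    filter_upwards [Ioo_mem_nhdsGT (half_pos (sub_pos.2 hκ))] with δ hδ
    refine iSup₂_mono fun X _ => ?_
    rw [hshift]
    exact X.sep_le_obsDiam (by linarith [hδ.1]) (by linarith [hδ.2])
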